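/- Let $V$ be a countably infinite set, let $m:V\to(0,\infty)$, and let $b:V\times V\to[0,\infty)$ be symmetric with zero diagonal. Write $x\sim y$ if $b(x,y)>0$, and assume that the resulting graph is connected and locally finite (every vertex has only finitely many neighbors). Let $\ell^2(V,m)$ be the Hilbert space of functions $f:V\to\mathbb R$ with $\sum_x f(x)^2m(x)<\infty$, with inner product $\langle f,g\rangle=\sum_x f(x)g(x)m(x)$. Let $$Q(f,g)=\tfrac12\sum_{x,y\in V}b(x,y)\,(f(x)-f(y))(g(x)-g(y)),$$ with domain $D(Q)$ the closure of the finitely supported functions in $\ell^2(V,m)$ with respect to $\langle\cdot,\cdot\rangle+Q(\cdot,\cdot)$, and let $L$ be the positive self-adjoint operator on $\ell^2(V,m)$ associated with $(Q,D(Q))$, that is, $f\in D(L)$ and $Lf=h$ if and only if $f\in D(Q)$, $h\in\ell^2(V,m)$, and $Q(f,g)=\langle h,g\rangle$ for all $g\in D(Q)$. For a vertex $x_0$ let $S_r$ and $B_r$ be the sphere and the ball of radius $r$ around $x_0$ in the combinatorial graph distance ($S_{-1}=\emptyset$), and for $x\in S_r$ put $\kappa_\pm(x)=\frac1{m(x)}\sum_{y\in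 S_{r\pm1}}b(x,y)$. Assume that $(V,b,m)$ is weakly spherically symmetric with root $x_0$, i.e. that $\kappa_+(x)$ and $\kappa_-(x)$ depend only on the distance of $x$ to $x_0$. Let $V_1(r)=\sum_{x\in B_r}m(x)$ and $\partial B(r)=\sum_{x\in S_r}\kappa_+(x)m(x)$. If $$a=\sum_{r=0}^\infty\frac{V_1(r)}{\partial B(r)}<\infty,$$ then the bottom $\lambda_0(L)=\inf\sigma(L)$ of the spectrum satisfies $\lambda_0(L)\ge\frac1a$, and the spectrum of $L$ is purely discrete: $\sigma(L)=\sigma_{\mathrm{disc}}(L)$, where $\sigma_{\mathrm{disc}}(L)$ is the set of isolated points of $\sigma(L)$ that are eigenvalues of finite multiplicity. -/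

import Mathlib

open MeasureTheory

/-- A locally finite, connected weighted graph `(V, b, m)` (without killing term): `m` is a strictly
positive vertex measure and `b` is a symmetric nonnegative edge weight with zero diagonal. -/
structure WeightedGraph (V : Type*) where
  /-- the edge weights -/
  b : V → V → ℝ
  /-- the vertex measure -/
  m : V → ℝ
  b_nonneg : ∀ x y, 0 ≤ b x y
  b_symm : ∀ x y, b x y = b y x
  b_diag : ∀ x, b x x = 0
  m_pos : ∀ x, 0 < m x
  locally_finite : ∀ x, {y | 0 < b x y}.Finite
  connected : ∀ x y, Relation.ReflTransGen (fun u v => 0 < b u v) x y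

namespace WeightedGraph

variable {V : Type*} (G : WeightedGraph V)

/-- The underlying combinatorial graph: `x ∼ y` iff `b x y > 0`. -/
def graph : SimpleGraph V where
  Adj x y := 0 < G.b x y
  symm := ⟨fun x y h => by rw [G.b_symm y x]; exact h⟩
  loopless := ⟨fun x h => by rw [G.b_diag x] at h; exact lt_irrefl _ h⟩

/-- The sphere `S_r(x₀)` for the combinatorial graph distance. -/
def sphere (x₀ : V) (r : ℕ) : Set V := {x | G.graph.dist x x₀ = r}

/-- The ball `B_r(x₀)` for the combinatorial graph distance. -/
def ball (x₀ : V) (r : ℕ) : Set V := {x | G.graph.dist x x₀ ≤ r}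

/-- The outer curvature `κ₊(x) = (1 / m(x)) ∑_{y ∈ S_{r+1}} b(x, y)` for `x ∈ S_r`
(a finite sum, by local finiteness). -/
noncomputable def outerCurvature (x₀ x : V) : ℝ :=
  (∑ᶠ y ∈ {y | G.graph.dist y x₀ = G.graph.dist x x₀ + 1}, G.b x y) / G.m x

/-- The inner curvature `κ₋(x) = (1 / m(x)) ∑_{y ∈ S_{r-1}} b(x, y)` for `x ∈ S_r`, where
`S_{-1} = ∅` (a finite sum, by local finiteness). -/
noncomputable def innerCurvature (x₀ x : V) : ℝ :=
  (∑ᶠ y ∈ {y | G.graph.dist y x₀ + 1 = G.graph.dist x x₀}, G.b x y) / G.m x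

/-- The values of `f` depend only on the distance to `x₀`. -/
def IsSphericallySymmetric (x₀ : V) (f : V → ℝ) : Prop :=
  ∃ g : ℕ → ℝ, ∀ x, f x = g (G.graph.dist x x₀)

/-- The graph is weakly spherically symmetric with root `x₀`. (The condition on the normalized
potential `c / m` is void, as there is no potential.) -/
def IsWeaklySphericallySymmetric (x₀ : V) : Prop :=
  G.IsSphericallySymmetric x₀ (G.outerCurvature x₀) ∧
    G.IsSphericallySymmetric x₀ (G.innerCurvature x₀)

/-- The volume `V_1(r) = m(B_r)` of a ball (balls are finite). -/
noncomputable def volumeBall (x₀ : V) (r : ℕ) : ℝ :=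
  ∑ᶠ x ∈ G.ball x₀ r, G.m x

/-- The measure `∂B(r) = ∑_{x ∈ S_r} κ₊(x) m(x)` of the boundary of a ball. -/
noncomputable def boundaryBall (x₀ : V) (r : ℕ) : ℝ :=
  ∑ᶠ x ∈ G.sphere x₀ r, G.outerCurvature x₀ x * G.m x

/-- The form `Q(f, g) = (1/2) ∑_{x, y} b(x, y) (f x - f y) (g x - g y)`. It is used only
for functions `f`, `g` of finite energy, for which the series converges absolutely. -/
noncomputable def form (f g : V → ℝ) : ℝ :=
  (1 / 2) * ∑' p : V × V, G.b p.1 p.2 * (f p.1 - f p.2) * (g p.1 - g p.2)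

/-- The energy `Q(f, f)` is finite. -/
def FiniteEnergy (f : V → ℝ) : Prop :=
  Summable fun p : V × V => G.b p.1 p.2 * (f p.1 - f p.2) * (f p.1 - f p.2)

/-- The measure on the discrete space `V` with point masses `m`. -/
noncomputable def measure [MeasurableSpace V] : Measure V :=
  Measure.sum fun x => ENNReal.ofReal (G.m x) • Measure.dirac x

/-- The real Hilbert space `ℓ²(V, m)`. As every point has positive mass, almost everywhere
equality is equality, and `f ∈ ℓ²(V, m)` has well defined values `f x`. -/
abbrev L2 [MeasurableSpace V] : Type _ := Lp ℝ 2 G.measure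

section Form

variable {G}

lemma FiniteEnergy.summable_mul {f g : V → ℝ} (hf : G.FiniteEnergy f) (hg : G.FiniteEnergy g) :
    Summable fun p : V × V => G.b p.1 p.2 * (f p.1 - f p.2) * (g p.1 - g p.2) := by
  refine Summable.of_norm_bounded (Summable.add hf hg) fun p => ?_
  have hb := G.b_nonneg p.1 p.2
  rw [mul_assoc, Real.norm_eq_abs, abs_mul, abs_of_nonneg hb, mul_assoc, mul_assoc, ← mul_add]
  refine mul_le_mul_of_nonneg_left ?_ hb
  rw [abs_le]
  generalize f p.1 - f p.2 = s
  generalize g p.1 - g p.2 = t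
  constructor
  · nlinarith [sq_nonneg (s + t), sq_nonneg s, sq_nonneg t]
  · nlinarith [sq_nonneg (s - t), sq_nonneg s, sq_nonneg t]

lemma FiniteEnergy.add {f g : V → ℝ} (hf : G.FiniteEnergy f) (hg : G.FiniteEnergy g) :
    G.FiniteEnergy (f + g) := by
  refine ((Summable.add hf hg).add (Summable.mul_left 2 (hf.summable_mul hg))).congr fun p => ?_
  simp only [Pi.add_apply]
  ring

lemma FiniteEnergy.smul {f : V → ℝ} (hf : G.FiniteEnergy f) (c : ℝ) :
    G.FiniteEnergy (c • f) := by
  refine (Summable.mul_left (c ^ 2) hf).congr fun p => ?_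
  simp only [Pi.smul_apply, smul_eq_mul]
  ring

lemma form_add_left {f₁ f₂ g : V → ℝ} (h₁ : G.FiniteEnergy f₁) (h₂ : G.FiniteEnergy f₂)
    (hg : G.FiniteEnergy g) : G.form (f₁ + f₂) g = G.form f₁ g + G.form f₂ g := by
  unfold form
  rw [← mul_add, ← (h₁.summable_mul hg).tsum_add (h₂.summable_mul hg)]
  congr 1
  refine tsum_congr fun p => ?_
  simp only [Pi.add_apply]
  ring

lemma form_smul_left (c : ℝ) (f g : V → ℝ) : G.form (c • f) g = c * G.form f g := by
  simp only [form, ← tsum_mul_left]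
  refine tsum_congr fun p => ?_
  simp only [Pi.smul_apply, smul_eq_mul]
  ring

lemma form_smul_smul (c : ℝ) (f : V → ℝ) : G.form (c • f) (c • f) = c ^ 2 * G.form f f := by
  simp only [form, ← tsum_mul_left]
  refine tsum_congr fun p => ?_
  simp only [Pi.smul_apply, smul_eq_mul]
  ring

lemma form_add_self_le {f g : V → ℝ} (hf : G.FiniteEnergy f) (hg : G.FiniteEnergy g) :
    G.form (f + g) (f + g) ≤ 2 * G.form f f + 2 * G.form g g := by
  have h : (∑' p : V × V, G.b p.1 p.2 * ((f + g) p.1 - (f + g) p.2) * ((f + g) p.1 - (f + g) p.2))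
      ≤ ∑' p : V × V, (2 * (G.b p.1 p.2 * (f p.1 - f p.2) * (f p.1 - f p.2)) +
        2 * (G.b p.1 p.2 * (g p.1 - g p.2) * (g p.1 - g p.2))) := by
    refine Summable.tsum_le_tsum (fun p => ?_) (FiniteEnergy.add hf hg)
      ((Summable.mul_left 2 hf).add (Summable.mul_left 2 hg))
    have h2 := mul_nonneg (G.b_nonneg p.1 p.2)
      (sq_nonneg ((f p.1 - f p.2) - (g p.1 - g p.2)))
    simp only [Pi.add_apply]
    nlinarith [h2]
  rw [(Summable.mul_left 2 hf).tsum_add (Summable.mul_left 2 hg), tsum_mul_left, tsum_mul_left] at h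
  unfold form
  linarith

lemma finiteEnergy_of_finite_support {f : V → ℝ} (hf : (Function.support f).Finite) :
    G.FiniteEnergy f := by
  have h1 : (⋃ x ∈ Function.support f, {x} ×ˢ {y | 0 < G.b x y}).Finite :=
    hf.biUnion fun x _ => (Set.finite_singleton x).prod (G.locally_finite x)
  have h2 : (⋃ x ∈ Function.support f, {y | 0 < G.b x y} ×ˢ {x}).Finite :=
    hf.biUnion fun x _ => (G.locally_finite x).prod (Set.finite_singleton x)
  refine summable_of_hasFiniteSupport ((h1.union h2).subset ?_)
  rintro ⟨x, y⟩ hxy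
  have hb : G.b x y ≠ 0 := by
    rintro h
    simp [h] at hxy
  have hb' : 0 < G.b x y := lt_of_le_of_ne (G.b_nonneg x y) hb.symm
  have hb'' : 0 < G.b y x := by rwa [G.b_symm y x]
  by_cases hx : f x = 0
  · have hy : f y ≠ 0 := by
      rintro h
      simp [h, hx] at hxy
    exact Or.inr (Set.mem_biUnion (x := y) hy ⟨hb'', rfl⟩)
  · exact Or.inl (Set.mem_biUnion (x := x) hx ⟨rfl, hb'⟩)

end Form

section L2

variable [MeasurableSpace V] [DiscreteMeasurableSpace V]

lemma eq_of_ae_eq {f g : V → ℝ} (h : f =ᵐ[G.measure] g) : f = g := by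
  ext x
  by_contra hx
  have h0 : G.measure {y | ¬ f y = g y} = 0 := h
  have h1 : G.measure {x} = 0 := measure_mono_null (by simpa using hx) h0
  rw [measure, Measure.sum_apply _ (MeasurableSet.of_discrete)] at h1
  have h2 := ENNReal.tsum_eq_zero.1 h1 x
  simp [(G.m_pos x).not_ge] at h2

lemma coe_add (f g : G.L2) : ((f + g : G.L2) : V → ℝ) = f + g := G.eq_of_ae_eq (Lp.coeFn_add f g)

lemma coe_sub (f g : G.L2) : ((f - g : G.L2) : V → ℝ) = f - g := G.eq_of_ae_eq (Lp.coeFn_sub f g)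

lemma coe_smul (c : ℝ) (f : G.L2) : ((c • f : G.L2) : V → ℝ) = c • (f : V → ℝ) :=
  G.eq_of_ae_eq (Lp.coeFn_smul c f)

lemma coe_zero : ((0 : G.L2) : V → ℝ) = 0 := G.eq_of_ae_eq (Lp.coeFn_zero ℝ 2 G.measure)

/-- The form domain `D(Q)`: the closure of the finitely supported functions in `ℓ²(V, m)` with
respect to `⟨·,·⟩_Q = ⟨·,·⟩ + Q(·,·)`. -/
def formDomain : Submodule ℝ G.L2 where
  carrier := {f | G.FiniteEnergy f ∧ ∀ ε > 0, ∃ φ : G.L2, (Function.support φ).Finite ∧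
    ‖f - φ‖ ^ 2 + G.form (f - φ : G.L2) (f - φ : G.L2) < ε}
  zero_mem' := by
    have h0 : (Function.support ((0 : G.L2) : V → ℝ)).Finite := by
      rw [G.coe_zero]
      simp
    refine ⟨finiteEnergy_of_finite_support h0, fun ε hε => ⟨0, h0, ?_⟩⟩
    have : G.form 0 0 = 0 := by simp [form]
    rw [sub_zero, G.coe_zero, this, norm_zero]
    simpa using hε
  add_mem' := by
    rintro f g ⟨hf, hf'⟩ ⟨hg, hg'⟩
    refine ⟨by rw [G.coe_add]; exact hf.add hg, fun ε hε => ?_⟩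
    obtain ⟨φ, hφ, h1⟩ := hf' (ε / 4) (by positivity)
    obtain ⟨ψ, hψ, h2⟩ := hg' (ε / 4) (by positivity)
    refine ⟨φ + ψ, ?_, ?_⟩
    · rw [G.coe_add]
      exact (hφ.union hψ).subset (Function.support_add _ _)
    · have e : f + g - (φ + ψ) = (f - φ) + (g - ψ) := by abel
      have fe : ∀ u v : G.L2, G.FiniteEnergy u → (Function.support v).Finite →
          G.FiniteEnergy (u - v : G.L2) := fun u v hu hv => by
        have := hu.add ((finiteEnergy_of_finite_support (G := G) hv).smul (-1))
        rw [G.coe_sub]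
        simpa [sub_eq_add_neg] using this
      have h3 := form_add_self_le (fe f φ hf hφ) (fe g ψ hg hψ)
      have h4 := norm_add_le (f - φ) (g - ψ)
      have h5 : ‖(f - φ) + (g - ψ)‖ ^ 2 ≤ 2 * ‖f - φ‖ ^ 2 + 2 * ‖g - ψ‖ ^ 2 := by
        nlinarith [norm_nonneg ((f - φ) + (g - ψ)), sq_nonneg (‖f - φ‖ - ‖g - ψ‖)]
      rw [e, G.coe_add]
      linarith
  smul_mem' := by
    rintro c f ⟨hf, hf'⟩
    refine ⟨by rw [G.coe_smul]; exact hf.smul c, fun ε hε => ?_⟩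
    obtain ⟨φ, hφ, h1⟩ := hf' (ε / (c ^ 2 + 1)) (by positivity)
    refine ⟨c • φ, ?_, ?_⟩
    · rw [G.coe_smul]
      exact hφ.subset (Function.support_const_smul_subset c _)
    · rw [← smul_sub, G.coe_smul, form_smul_smul, norm_smul, mul_pow, Real.norm_eq_abs, sq_abs]
      rw [lt_div_iff₀ (by positivity)] at h1
      have h0 : 0 ≤ ‖f - φ‖ ^ 2 + G.form (f - φ : G.L2) (f - φ : G.L2) := by
        refine add_nonneg (by positivity) (mul_nonneg (by norm_num) (tsum_nonneg fun p => ?_))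
        rw [mul_assoc]
        exact mul_nonneg (G.b_nonneg _ _) (mul_self_nonneg _)
      nlinarith

/-- The graph of the Laplacian: the pairs `(f, h)` with `f ∈ D(Q)` and
`Q(f, g) = ⟨h, g⟩` for all `g ∈ D(Q)`. -/
def laplacianGraph : Submodule ℝ (G.L2 × G.L2) where
  carrier := {p | p.1 ∈ G.formDomain ∧ ∀ g ∈ G.formDomain, G.form p.1 g = inner ℝ p.2 g}
  zero_mem' := by
    refine ⟨zero_mem _, fun g _ => ?_⟩
    rw [Prod.fst_zero, Prod.snd_zero, G.coe_zero, inner_zero_left]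
    simp [form]
  add_mem' := by
    rintro p q ⟨hp, hp'⟩ ⟨hq, hq'⟩
    refine ⟨add_mem hp hq, fun g hg => ?_⟩
    rw [Prod.fst_add, Prod.snd_add, G.coe_add, form_add_left hp.1 hq.1 hg.1, inner_add_left,
      hp' g hg, hq' g hg]
  smul_mem' := by
    rintro c p ⟨hp, hp'⟩
    refine ⟨Submodule.smul_mem _ c hp, fun g hg => ?_⟩
    rw [Prod.smul_fst, Prod.smul_snd, G.coe_smul, form_smul_left, hp' g hg, inner_smul_left]
    simp

/-- The Laplacian `L`, i.e. the (positive, self-adjoint) operator associated with the closed form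
`Q` on `D(Q)`: its domain consists of the `f ∈ D(Q)` for which there is `h ∈ ℓ²(V, m)` with
`Q(f, g) = ⟨h, g⟩` for all `g ∈ D(Q)`, and `L f = h`. (By density of `D(Q)` the function `h`
is unique, see `laplacianGraph_snd_eq_zero` and `laplacian_graph` below.) -/
noncomputable def laplacian : G.L2 →ₗ.[ℝ] G.L2 := G.laplacianGraph.toLinearPMap

lemma laplacianGraph_snd_eq_zero {p : G.L2 × G.L2} (hp : p ∈ G.laplacianGraph)
    (h : p.1 = 0) : p.2 = 0 := by
  have h0 : ∀ g ∈ G.formDomain, inner ℝ p.2 g = 0 := fun g hg => by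
    rw [← hp.2 g hg, h, G.coe_zero]
    simp [form]
  apply Lp.ext
  refine Filter.EventuallyEq.trans (Filter.Eventually.of_forall fun x => ?_)
    (Lp.coeFn_zero ℝ 2 G.measure).symm
  have hx : G.measure {x} ≠ ⊤ := by
    rw [measure, Measure.sum_apply _ (MeasurableSet.of_discrete), tsum_eq_single x]
    · simp
    · intro y hy
      simp [hy]
  have hx0 : G.measure.real {x} ≠ 0 := by
    refine (ENNReal.toReal_pos (fun h => ?_) hx).ne'
    rw [measure, Measure.sum_apply _ (MeasurableSet.of_discrete)] at h
    have h2 := ENNReal.tsum_eq_zero.1 h x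
    simp [(G.m_pos x).not_ge] at h2
  set δ : G.L2 := indicatorConstLp 2 (MeasurableSet.of_discrete (s := {x})) hx (1 : ℝ) with hδ
  have hc : (δ : V → ℝ) = Set.indicator {x} fun _ => (1 : ℝ) :=
    G.eq_of_ae_eq indicatorConstLp_coeFn
  have hs : (Function.support (δ : V → ℝ)).Finite := by
    rw [hc]
    exact (Set.finite_singleton x).subset Set.support_indicator_subset
  have hmem : δ ∈ G.formDomain := by
    refine ⟨finiteEnergy_of_finite_support hs, fun ε hε => ⟨δ, hs, ?_⟩⟩
    have : G.form 0 0 = 0 := by simp [form]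
    rw [sub_self, G.coe_zero, this, norm_zero]
    simpa using hε
  have h1 := h0 δ hmem
  rw [real_inner_comm, hδ, L2.inner_indicatorConstLp_one] at h1
  simp only [integral_singleton, smul_eq_mul] at h1
  exact (mul_eq_zero.1 h1).resolve_left hx0

lemma laplacian_graph : G.laplacian.graph = G.laplacianGraph :=
  Submodule.toLinearPMap_graph_eq _ fun _ hp h => G.laplacianGraph_snd_eq_zero hp h

end L2

end WeightedGraph

/-! ### Spectral notions for unbounded operators

The operators are real; for a self-adjoint operator the real spectrum defined here is the spectrum
of its complexification. -/

namespace UnboundedSpectrum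

variable {E : Type*} [NormedAddCommGroup E] [InnerProductSpace ℝ E]

/-- `lam` belongs to the resolvent set of `T`: the map `T - lam : D(T) → E` is a bijection with
bounded inverse `R`. -/
def IsRegular (T : E →ₗ.[ℝ] E) (lam : ℝ) : Prop :=
  ∃ R : E →L[ℝ] E, (∀ f : T.domain, R (T f - lam • (f : E)) = f) ∧
    ∀ g : E, ∃ hg : R g ∈ T.domain, T ⟨R g, hg⟩ - lam • R g = g

/-- The spectrum of `T`. -/
def spec (T : E →ₗ.[ℝ] E) : Set ℝ := {lam | ¬ IsRegular T lam}

/-- The bottom of the spectrum. -/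
noncomputable def bottom (T : E →ₗ.[ℝ] E) : ℝ := sInf (spec T)

/-- The eigenspace `ker (T - lam)`. -/
def eigenspace (T : E →ₗ.[ℝ] E) (lam : ℝ) : Submodule ℝ E :=
  (LinearMap.ker (T.toFun - lam • T.domain.subtype)).map T.domain.subtype

/-- The discrete spectrum: the isolated points of the spectrum which are eigenvalues of finite
multiplicity. -/
def discreteSpec (T : E →ₗ.[ℝ] E) : Set ℝ :=
  {lam | lam ∈ spec T ∧ (∃ ε > 0, ∀ mu ∈ spec T, |mu - lam| < ε → mu = lam) ∧
    eigenspace T lam ≠ ⊥ ∧ FiniteDimensional ℝ (eigenspace T lam)}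

end UnboundedSpectrum

/-! Convergence of the series yields a torsion function: a radial `w` that drops by `V_1(r)/∂B(r)`
from `S_r` to `S_{r+1}`. Its flux out of `B_r` is then exactly the volume of `B_r`, which by
spherical symmetry gives `L w = 1` at every vertex; moreover `0 < w ≤ a`, and `w` tends to `0` at
infinity (`exists_torsion_function`). A positive function with `L w = 1` forces the Hardy inequality
`∑ φ² m / w ≤ Q(φ, φ)`, by Green's formula tested with `φ² / w` (`sum_le_form`), and this passes to
the form domain by closure. Both claims follow from it. As `w ≤ a` everywhere, `‖f‖² ≤ a Q(f, f)`.
As `{w ≥ ε}` is finite, the mass of `f` outside a finite set is at most `ε Q(f, f)`, so the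
embedding `J` of the form domain into `ℓ²` is a norm limit of finite-rank maps, hence compact
(`isCompactOperator_embedding`). Then `(L + 1)⁻¹ = J J*` is compact and symmetric, and
`spec_eq_discreteSpec_of_compact_resolvent` concludes. -/

/-- A uniform limit of compact operators is compact. -/
lemma isCompactOperator_of_forall_exists_norm_sub_le {E F : Type*} [NormedAddCommGroup E]
    [NormedSpace ℝ E] [NormedAddCommGroup F] [NormedSpace ℝ F] [CompleteSpace F] {T : E →L[ℝ] F}
    (h : ∀ ε > 0, ∃ S : E →L[ℝ] F, IsCompactOperator S ∧ ∀ x, ‖T x - S x‖ ≤ ε * ‖x‖) :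
    IsCompactOperator T := by
  have hcl := isClosed_setOfPred_isCompactOperator (σ₁₂ := RingHom.id ℝ) (M₁ := E) (M₂ := F)
  suffices h : T ∈ closure {S : E →L[ℝ] F | IsCompactOperator S} by
    rwa [hcl.closure_eq] at h
  refine Metric.mem_closure_iff.2 fun ε hε => ?_
  obtain ⟨S, hS, hS'⟩ := h (ε / 2) (half_pos hε)
  refine ⟨S, hS, ?_⟩
  rw [dist_eq_norm]
  exact (ContinuousLinearMap.opNorm_le_bound _ (half_pos hε).le hS').trans_lt (half_lt_self hε)

/-! ### Spectrum of an operator with compact resolvent -/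

namespace UnboundedSpectrum

open Filter Topology Module End

variable {E : Type*} [NormedAddCommGroup E] [InnerProductSpace ℝ E]

/-- The nonzero eigenvalues of a compact symmetric operator are isolated from each other. -/
lemma exists_forall_hasEigenvalue_eq {K : E →L[ℝ] E} (hK : IsCompactOperator K)
    (hs : (K : E →ₗ[ℝ] E).IsSymmetric) {ν : ℝ} (hν : ν ≠ 0) :
    ∃ ε > 0, ∀ ν', HasEigenvalue (K : End ℝ E) ν' → |ν' - ν| < ε → ν' = ν := by
  -- Otherwise there are unit eigenvectors `e n` with eigenvalues `μ n ≠ ν` tending to `ν`. By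
  -- compactness a subsequence converges to a unit eigenvector `u` for `ν`; but every `e n` is
  -- orthogonal to `u`, so `⟨u, u⟩ = 0`.
  by_contra! hcon
  have h1 : ∀ n : ℕ, ∃ ν', ∃ e : E, ‖e‖ = 1 ∧ K e = ν' • e ∧ |ν' - ν| < 1 / ((n : ℝ) + 1) ∧
      ν' ≠ ν := by
    intro n
    obtain ⟨ν', h, h2, h3⟩ := hcon (1 / ((n : ℝ) + 1)) (by positivity)
    obtain ⟨v, hv⟩ := h.exists_hasEigenvector
    have hv1 : K v = ν' • v := hv.apply_eq_smul
    refine ⟨ν', (‖v‖⁻¹ : ℝ) • v, norm_smul_inv_norm hv.2, ?_, h2, h3⟩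
    rw [map_smul, hv1, smul_comm]
  choose μ e he hKe hμ hne using h1
  have hlim : Tendsto μ atTop (𝓝 ν) := by
    rw [tendsto_iff_norm_sub_tendsto_zero]
    exact squeeze_zero (fun _ => norm_nonneg _) (fun n => (hμ n).le)
      tendsto_one_div_add_atTop_nhds_zero_nat
  obtain ⟨C, hC, hC'⟩ := hK.image_closedBall_subset_compact 1
  obtain ⟨y, -, ψ, hψ, hy⟩ := hC.tendsto_subseq (x := fun n => K (e n))
    (fun n => hC' ⟨e n, by simp [he], rfl⟩)
  have hμψ : Tendsto (fun n => (μ (ψ n))⁻¹) atTop (𝓝 ν⁻¹) :=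
    (hlim.comp hψ.tendsto_atTop).inv₀ hν
  -- `e n = (μ n)⁻¹ K (e n)` whenever `μ n ≠ 0`, which holds eventually because `ν ≠ 0`.
  have he' : Tendsto (fun n => e (ψ n)) atTop (𝓝 (ν⁻¹ • y)) := by
    refine (hμψ.smul hy).congr' ?_
    have h0 : ∀ᶠ n in atTop, μ (ψ n) ≠ 0 := (hlim.comp hψ.tendsto_atTop).eventually_ne hν
    filter_upwards [h0] with n hn
    simp only [Function.comp_apply, hKe, smul_smul]
    rw [inv_mul_cancel₀ hn, one_smul]
  set u := ν⁻¹ • y with hu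
  have hun : ‖u‖ = 1 := by
    have := he'.norm
    simp only [he] at this
    exact tendsto_nhds_unique this tendsto_const_nhds
  have hKu : K u = ν • u := by
    refine tendsto_nhds_unique ((K.continuous.tendsto u).comp he') ?_
    refine ((hlim.comp hψ.tendsto_atTop).smul he').congr fun n => ?_
    simp [hKe]
  have horth : ∀ n, inner ℝ (e n) u = 0 := by
    intro n
    have h2 := hs (e n) u
    simp only [ContinuousLinearMap.coe_coe, hKe, hKu, inner_smul_left, inner_smul_right] at h2
    have h3 : (μ n - ν) * inner ℝ (e n) u = 0 := by
      simp only [conj_trivial] at h2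
      linarith
    exact (mul_eq_zero.1 h3).resolve_left (sub_ne_zero.2 (hne n))
  have h4 : Tendsto (fun n => inner ℝ (e (ψ n)) u) atTop (𝓝 (inner ℝ u u)) :=
    he'.inner tendsto_const_nhds
  simp only [horth] at h4
  have h5 := tendsto_nhds_unique h4 tendsto_const_nhds
  rw [real_inner_self_eq_norm_sq, hun] at h5
  norm_num at h5

lemma mem_eigenspace_iff {T : E →ₗ.[ℝ] E} {lam : ℝ} {f : E} :
    f ∈ eigenspace T lam ↔ ∃ hf : f ∈ T.domain, T ⟨f, hf⟩ = lam • f := by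
  simp only [eigenspace, Submodule.mem_map, LinearMap.mem_ker, LinearMap.sub_apply,
    LinearMap.smul_apply, sub_eq_zero, Submodule.subtype_apply]
  constructor
  · rintro ⟨⟨g, hg⟩, h, rfl⟩
    exact ⟨hg, h⟩
  · rintro ⟨hf, h⟩
    exact ⟨⟨f, hf⟩, h, rfl⟩

section CompactResolvent

variable {T : E →ₗ.[ℝ] E} {K : E →L[ℝ] E}

/-- If `K = (T + 1)⁻¹`, then the eigenspaces of `T` are those of `K`. -/
lemma eigenspace_eq_of_resolvent (hl : ∀ f : T.domain, K (T f + f) = f)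
    (hr : ∀ g : E, ∃ hg : K g ∈ T.domain, T ⟨K g, hg⟩ + K g = g) {lam : ℝ} (hlam : lam + 1 ≠ 0) :
    eigenspace T lam = End.eigenspace (K : End ℝ E) (lam + 1)⁻¹ := by
  ext f
  rw [mem_eigenspace_iff, End.mem_eigenspace_iff, ContinuousLinearMap.coe_coe]
  constructor
  · rintro ⟨hf, h⟩
    have h1 := hl ⟨f, hf⟩
    rw [h] at h1
    have h2 : lam • f + f = (lam + 1) • f := by module
    rw [h2, map_smul] at h1
    rw [eq_inv_smul_iff₀ hlam]
    exact h1
  · intro h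
    obtain ⟨hg, h1⟩ := hr f
    have hf : f ∈ T.domain := by
      have h2 := T.domain.smul_mem (lam + 1) hg
      rwa [h, smul_inv_smul₀ hlam] at h2
    refine ⟨hf, ?_⟩
    have h3 : (⟨K f, hg⟩ : T.domain) = (lam + 1)⁻¹ • ⟨f, hf⟩ := Subtype.ext h
    rw [h3, T.map_smul, h, ← smul_add, inv_smul_eq_iff₀ hlam] at h1
    rw [eq_sub_of_add_eq h1]
    module

variable [CompleteSpace E]

/-- If `K = (T + 1)⁻¹` is compact, then the spectrum of `T` consists of eigenvalues. -/
lemma eigenspace_ne_bot_of_mem_spec (hK : IsCompactOperator K)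
    (hl : ∀ f : T.domain, K (T f + f) = f)
    (hr : ∀ g : E, ∃ hg : K g ∈ T.domain, T ⟨K g, hg⟩ + K g = g) {lam : ℝ}
    (h : lam ∈ spec T) : lam + 1 ≠ 0 ∧ eigenspace T lam ≠ ⊥ := by
  -- At `-1` the operator `K` is itself the bounded inverse, so `-1` is not in the spectrum.
  have h0 : lam + 1 ≠ 0 := by
    intro h0
    have h1 : lam = -1 := by linarith
    refine h ⟨K, fun f => ?_, fun g => ?_⟩
    · rw [h1, neg_one_smul, sub_neg_eq_add, hl]
    · obtain ⟨hg, h2⟩ := hr g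
      exact ⟨hg, by rw [h1, neg_one_smul, sub_neg_eq_add, h2]⟩
  refine ⟨h0, ?_⟩
  rw [eigenspace_eq_of_resolvent hl hr h0]
  by_contra h1
  -- Fredholm alternative for `K`: without an eigenvector, `U = (lam + 1)⁻¹ - K` is invertible.
  have h2 := (hK.hasEigenvalue_or_mem_resolventSet (inv_ne_zero h0)).resolve_left fun h => h h1
  rw [spectrum.mem_resolventSet_iff] at h2
  obtain ⟨U, hU⟩ := h2
  -- This inverts the factorization `T - lam = (lam + 1) U (T + 1)`.
  refine h ⟨(lam + 1)⁻¹ • (K * (↑U⁻¹ : E →L[ℝ] E)), ?_, ?_⟩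
  all_goals
    have hUa : ∀ x, (U : E →L[ℝ] E) x = (lam + 1)⁻¹ • x - K x := fun x => by
      rw [hU]
      simp [Algebra.algebraMap_eq_smul_one]
    have hc1 : ∀ x, (U : E →L[ℝ] E) ((↑U⁻¹ : E →L[ℝ] E) x) = x := fun x => by
      rw [← mul_apply_eq_comp, Units.mul_inv, one_apply_eq_self]
    have hc2 : ∀ x, (↑U⁻¹ : E →L[ℝ] E) ((U : E →L[ℝ] E) x) = x := fun x => by
      rw [← mul_apply_eq_comp, Units.inv_mul, one_apply_eq_self]
  · intro f
    have h3 : T f - lam • (f : E) = (lam + 1) • (U : E →L[ℝ] E) (T f + f) := by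
      rw [hUa, smul_sub, smul_inv_smul₀ h0, hl]
      module
    rw [h3, smul_apply, mul_apply_eq_comp, map_smul, hc2, map_smul,
      inv_smul_smul₀ h0, hl]
  · intro g
    set z := (↑U⁻¹ : E →L[ℝ] E) g with hz
    obtain ⟨hg, h3⟩ := hr z
    have h4 : ((lam + 1)⁻¹ • (K * (↑U⁻¹ : E →L[ℝ] E))) g = (lam + 1)⁻¹ • K z := by
      simp [hz]
    have h5 := T.domain.smul_mem (lam + 1)⁻¹ hg
    refine ⟨h4 ▸ h5, ?_⟩
    have h6 : (⟨((lam + 1)⁻¹ • (K * (↑U⁻¹ : E →L[ℝ] E))) g, h4 ▸ h5⟩ : T.domain) =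
      (lam + 1)⁻¹ • ⟨K z, hg⟩ := Subtype.ext h4
    have h7 := hc1 g
    rw [← hz, hUa] at h7
    rw [h6, T.map_smul, h4, eq_sub_of_add_eq h3]
    have h8 : lam * (lam + 1)⁻¹ + (lam + 1)⁻¹ = 1 := by field_simp
    have h9 : (lam + 1)⁻¹ • (z - K z) - lam • (lam + 1)⁻¹ • K z =
      (lam + 1)⁻¹ • z - (lam * (lam + 1)⁻¹ + (lam + 1)⁻¹) • K z := by module
    rw [h9, h8, one_smul, h7]

/-- An operator with compact symmetric resolvent at `-1` that is bounded below by `c` has nonempty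
purely discrete spectrum, contained in `[c, ∞)`. -/
theorem spec_eq_discreteSpec_of_compact_resolvent [Nontrivial E] (hK : IsCompactOperator K)
    (hs : (K : E →ₗ[ℝ] E).IsSymmetric) (hl : ∀ f : T.domain, K (T f + f) = f)
    (hr : ∀ g : E, ∃ hg : K g ∈ T.domain, T ⟨K g, hg⟩ + K g = g) {c : ℝ}
    (hc : ∀ f : T.domain, c * ‖(f : E)‖ ^ 2 ≤ inner ℝ (T f) (f : E)) :
    (spec T).Nonempty ∧ (∀ lam ∈ spec T, c ≤ lam) ∧ spec T = discreteSpec T := by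
  have hmem : ∀ {lam : ℝ}, eigenspace T lam ≠ ⊥ → lam ∈ spec T := by
    rintro lam h ⟨R, hR, -⟩
    obtain ⟨f, hf, hf0⟩ := Submodule.exists_mem_ne_zero_of_ne_bot h
    obtain ⟨hd, hT⟩ := mem_eigenspace_iff.1 hf
    have h1 := hR ⟨f, hd⟩
    rw [hT, sub_self, map_zero] at h1
    exact hf0 h1.symm
  refine ⟨?_, ?_, ?_⟩
  -- `K` is injective on a nontrivial space, hence nonzero, and a nonzero compact symmetric operator
  -- has a nonzero eigenvalue `ν`; it corresponds to the eigenvalue `ν⁻¹ - 1` of `T`.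
  · have hK0 : (K : E →ₗ[ℝ] E) ≠ 0 := by
      intro h0
      obtain ⟨g, hg⟩ := exists_ne (0 : E)
      obtain ⟨hd, h1⟩ := hr g
      have h2 : K g = 0 := congrArg (fun S : E →ₗ[ℝ] E => S g) h0
      have h3 : (⟨K g, hd⟩ : T.domain) = 0 := Subtype.ext h2
      rw [h3, T.map_zero, h2, add_zero] at h1
      exact hg h1.symm
    obtain ⟨ν, hν, hν0⟩ : ∃ ν, HasEigenvalue (K : End ℝ E) ν ∧ ν ≠ 0 := by
      by_contra! hcon
      exact hK0 (ContinuousLinearMap.coe_inj.2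
        ((ContinuousLinearMap.eq_zero_of_forall_hasEigenvalue_eq_zero hK hs).1 hcon))
    refine ⟨ν⁻¹ - 1, hmem ?_⟩
    have h2 : ν⁻¹ - 1 + 1 = ν⁻¹ := by ring
    rw [eigenspace_eq_of_resolvent hl hr (by rw [h2]; exact inv_ne_zero hν0), h2, inv_inv]
    exact hν
  · intro lam h
    obtain ⟨h0, h1⟩ := eigenspace_ne_bot_of_mem_spec hK hl hr h
    obtain ⟨f, hf, hf0⟩ := Submodule.exists_mem_ne_zero_of_ne_bot h1
    obtain ⟨hd, hT⟩ := mem_eigenspace_iff.1 hf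
    have h2 := hc ⟨f, hd⟩
    rw [hT, inner_smul_left, real_inner_self_eq_norm_sq] at h2
    have h3 : 0 < ‖f‖ ^ 2 := by positivity
    exact le_of_mul_le_mul_right (by simpa using h2) h3
  · refine Set.Subset.antisymm (fun lam h => ?_) fun lam h => h.1
    obtain ⟨h0, h1⟩ := eigenspace_ne_bot_of_mem_spec hK hl hr h
    refine ⟨h, ?_, h1, ?_⟩
    · obtain ⟨ε, hε, hiso⟩ := exists_forall_hasEigenvalue_eq hK hs (inv_ne_zero h0)
      -- The injective map `mu ↦ (mu + 1)⁻¹`, continuous at `lam`, carries isolation of eigenvalues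
      -- of `K` back to the spectrum of `T`.
      have hcont : ContinuousAt (fun mu : ℝ => (mu + 1)⁻¹) lam :=
        (continuousAt_id.add continuousAt_const).inv₀ h0
      obtain ⟨δ, hδ, hclose⟩ := Metric.continuousAt_iff.1 hcont ε hε
      refine ⟨δ, hδ, fun mu hmu hd => ?_⟩
      obtain ⟨h2, h3⟩ := eigenspace_ne_bot_of_mem_spec hK hl hr hmu
      rw [eigenspace_eq_of_resolvent hl hr h2] at h3
      have h4 := hiso _ h3 (hclose hd)
      have h5 := inv_injective h4
      linarith
    · rw [eigenspace_eq_of_resolvent hl hr h0]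
      exact ContinuousLinearMap.finite_dimensional_eigenspace hK _ (inv_ne_zero h0)

end CompactResolvent

end UnboundedSpectrum

/-! ### Balls, spheres and curvatures -/

namespace WeightedGraph

open Filter Topology

variable {V : Type*} (G : WeightedGraph V)

lemma graph_connected [Nonempty V] : G.graph.Connected := by
  refine ⟨fun x y => ?_⟩
  induction G.connected x y with
  | refl => exact SimpleGraph.Reachable.refl _
  | tail _ h ih => exact ih.trans (SimpleGraph.Adj.reachable (G := G.graph) h)

lemma dist_le_dist_add_one (x₀ : V) {x y : V} (h : 0 < G.b x y) :
    G.graph.dist y x₀ ≤ G.graph.dist x x₀ + 1 := by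
  have : Nonempty V := ⟨x₀⟩
  have h1 := G.graph_connected.dist_triangle (u := y) (v := x) (w := x₀)
  have h2 : G.graph.dist y x = 1 :=
    SimpleGraph.dist_eq_one_iff_adj.2 (SimpleGraph.Adj.symm (G := G.graph) h)
  omega

lemma exists_pos_of_dist_eq_succ (x₀ : V) {y : V} {r : ℕ} (h : G.graph.dist y x₀ = r + 1) :
    ∃ x, G.graph.dist x x₀ = r ∧ 0 < G.b x y := by
  have : Nonempty V := ⟨x₀⟩
  obtain ⟨p, hp⟩ := G.graph_connected.exists_walk_length_eq_dist y x₀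
  rw [h] at hp
  cases p with
  | nil => simp at hp
  | @cons _ x _ hadj q =>
    have h1 : 0 < G.b x y := SimpleGraph.Adj.symm (G := G.graph) hadj
    refine ⟨x, ?_, h1⟩
    have h2 := SimpleGraph.dist_le q
    have h3 := G.dist_le_dist_add_one x₀ h1
    rw [SimpleGraph.Walk.length_cons] at hp
    omega

lemma finite_ball (x₀ : V) (r : ℕ) : (G.ball x₀ r).Finite := by
  have : Nonempty V := ⟨x₀⟩
  induction r with
  | zero =>
    refine (Set.finite_singleton x₀).subset fun x hx => ?_
    exact G.graph_connected.dist_eq_zero_iff.1 (Nat.le_zero.1 hx)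
  | succ r ih =>
    refine (ih.union (ih.biUnion fun x _ => G.locally_finite x)).subset fun y hy => ?_
    rcases Nat.lt_or_ge (G.graph.dist y x₀) (r + 1) with h | h
    · exact Or.inl (Nat.lt_succ_iff.1 h)
    · obtain ⟨x, hx, hb⟩ := G.exists_pos_of_dist_eq_succ x₀ (le_antisymm hy h)
      exact Or.inr (Set.mem_biUnion (x := x) hx.le hb)

lemma finite_sphere (x₀ : V) (r : ℕ) : (G.sphere x₀ r).Finite :=
  (G.finite_ball x₀ r).subset fun _ hx => le_of_eq hx

/-- Finite balls cannot exhaust an infinite graph, and a shortest path from a vertex outside `B_r`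
to the root meets `S_r`. -/
lemma sphere_nonempty [Infinite V] (x₀ : V) (r : ℕ) : (G.sphere x₀ r).Nonempty := by
  have h1 : ∀ k, (G.sphere x₀ (r + k)).Nonempty → (G.sphere x₀ r).Nonempty := by
    intro k
    induction k with
    | zero => exact id
    | succ k ih =>
      rintro ⟨y, hy⟩
      obtain ⟨x, hx, -⟩ := G.exists_pos_of_dist_eq_succ x₀ (r := r + k) hy
      exact ih ⟨x, hx⟩
  obtain ⟨x, hx⟩ := (G.finite_ball x₀ r).exists_notMem
  have hx' : r < G.graph.dist x x₀ := not_le.1 hx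
  exact h1 (G.graph.dist x x₀ - r) ⟨x, by simp only [sphere, Set.mem_ofPred_eq]; omega⟩

/-- The finite set of neighbors of a vertex. -/
noncomputable def neighbors (x : V) : Finset V := (G.locally_finite x).toFinset

lemma mem_neighbors {x y : V} : y ∈ G.neighbors x ↔ 0 < G.b x y := by
  simp [neighbors]

lemma b_eq_zero_of_notMem {x y : V} (h : y ∉ G.neighbors x) : G.b x y = 0 :=
  le_antisymm (not_lt.1 fun h' => h (G.mem_neighbors.2 h')) (G.b_nonneg x y)

/-- The formal Laplacian, without the factor `1 / m`. -/
noncomputable def formalLaplacian (w : V → ℝ) (x : V) : ℝ :=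
  ∑ y ∈ G.neighbors x, G.b x y * (w x - w y)

/-- The finite sphere as a `Finset`. -/
noncomputable def sphereFinset (x₀ : V) (r : ℕ) : Finset V := (G.finite_sphere x₀ r).toFinset

lemma mem_sphereFinset {x₀ x : V} {r : ℕ} : x ∈ G.sphereFinset x₀ r ↔ G.graph.dist x x₀ = r := by
  simp [sphereFinset, sphere]

lemma finsum_b_eq_sum (x₀ x : V) (r : ℕ) :
    ∑ᶠ y ∈ {y | G.graph.dist y x₀ = r}, G.b x y = ∑ y ∈ G.sphereFinset x₀ r, G.b x y :=
  finsum_mem_eq_finite_toFinset_sum _ (G.finite_sphere x₀ r)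

lemma outerCurvature_mul (x₀ x : V) :
    G.outerCurvature x₀ x * G.m x = ∑ y ∈ G.sphereFinset x₀ (G.graph.dist x x₀ + 1), G.b x y := by
  rw [outerCurvature, div_mul_cancel₀ _ (G.m_pos x).ne', finsum_b_eq_sum]

lemma innerCurvature_mul (x₀ : V) {x : V} {r : ℕ} (h : G.graph.dist x x₀ = r + 1) :
    G.innerCurvature x₀ x * G.m x = ∑ y ∈ G.sphereFinset x₀ r, G.b x y := by
  rw [innerCurvature, div_mul_cancel₀ _ (G.m_pos x).ne', ← finsum_b_eq_sum, h]
  simp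

lemma innerCurvature_eq_zero (x₀ : V) {x : V} (h : G.graph.dist x x₀ = 0) :
    G.innerCurvature x₀ x = 0 := by
  simp [innerCurvature, h]

lemma sum_sphereFinset_eq_sum_neighbors (x₀ x : V) (r : ℕ) :
    ∑ y ∈ G.sphereFinset x₀ r, G.b x y =
      ∑ y ∈ G.neighbors x, if G.graph.dist y x₀ = r then G.b x y else 0 := by
  classical
  rw [← Finset.sum_filter]
  symm
  refine Finset.sum_subset_zero_on_sdiff (fun y hy => ?_) (fun y hy => ?_) fun _ _ => rfl
  · exact G.mem_sphereFinset.2 (Finset.mem_filter.1 hy).2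
  · rw [Finset.mem_sdiff, G.mem_sphereFinset, Finset.mem_filter] at hy
    exact G.b_eq_zero_of_notMem fun h => hy.2 ⟨h, hy.1⟩

/-- The formal Laplacian of a radial function. -/
lemma formalLaplacian_radial (x₀ : V) (v : ℕ → ℝ) (x : V) :
    G.formalLaplacian (fun y => v (G.graph.dist y x₀)) x =
      G.outerCurvature x₀ x * G.m x *
        (v (G.graph.dist x x₀) - v (G.graph.dist x x₀ + 1)) +
      G.innerCurvature x₀ x * G.m x *
        (v (G.graph.dist x x₀) - v (G.graph.dist x x₀ - 1)) := by
  have hle : ∀ y ∈ G.neighbors x, G.graph.dist y x₀ ≤ G.graph.dist x x₀ + 1 ∧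
      G.graph.dist x x₀ ≤ G.graph.dist y x₀ + 1 := fun y hy => by
    have h := G.mem_neighbors.1 hy
    exact ⟨G.dist_le_dist_add_one x₀ h, G.dist_le_dist_add_one x₀ (by rwa [G.b_symm])⟩
  rw [formalLaplacian, outerCurvature_mul, sum_sphereFinset_eq_sum_neighbors]
  rcases hr : G.graph.dist x x₀ with _ | r
  -- At the root the truncated `0 - 1` is harmless: its coefficient, the inner curvature, vanishes.
  · rw [innerCurvature_eq_zero G x₀ hr, zero_mul, zero_mul, add_zero, Finset.sum_mul]
    refine Finset.sum_congr rfl fun y hy => ?_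
    have h := hle y hy
    rw [hr] at h
    split_ifs with h1
    · rw [h1]
    · rw [show G.graph.dist y x₀ = 0 by omega]
      simp
  · rw [G.innerCurvature_mul x₀ hr, sum_sphereFinset_eq_sum_neighbors, Finset.sum_mul,
      Finset.sum_mul, ← Finset.sum_add_distrib]
    refine Finset.sum_congr rfl fun y hy => ?_
    have h := hle y hy
    rw [hr] at h
    -- Neighbors in the same sphere contribute nothing, since a radial function is constant there.
    rcases (by omega : G.graph.dist y x₀ = r ∨ G.graph.dist y x₀ = r + 1 ∨
      G.graph.dist y x₀ = r + 1 + 1) with h1 | h1 | h1 <;>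
      simp [h1, show r ≠ r + 1 + 1 by omega, show r + 1 + 1 ≠ r by omega]

/-! ### Boundary measures and the torsion function -/

/-- The measure of a sphere. -/
noncomputable def sphereMeasure (x₀ : V) (r : ℕ) : ℝ := ∑ x ∈ G.sphereFinset x₀ r, G.m x

lemma sphereMeasure_pos [Infinite V] (x₀ : V) (r : ℕ) : 0 < G.sphereMeasure x₀ r := by
  obtain ⟨x, hx⟩ := G.sphere_nonempty x₀ r
  exact Finset.sum_pos (fun y _ => G.m_pos y) ⟨x, G.mem_sphereFinset.2 hx⟩

lemma boundaryBall_eq_sum (x₀ : V) (r : ℕ) : G.boundaryBall x₀ r =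
    ∑ x ∈ G.sphereFinset x₀ r, G.outerCurvature x₀ x * G.m x :=
  finsum_mem_eq_finite_toFinset_sum _ (G.finite_sphere x₀ r)

lemma boundaryBall_eq_sum_sum (x₀ : V) (r : ℕ) : G.boundaryBall x₀ r =
    ∑ x ∈ G.sphereFinset x₀ r, ∑ y ∈ G.sphereFinset x₀ (r + 1), G.b x y := by
  rw [boundaryBall_eq_sum]
  refine Finset.sum_congr rfl fun x hx => ?_
  rw [outerCurvature_mul, G.mem_sphereFinset.1 hx]

lemma boundaryBall_pos [Infinite V] (x₀ : V) (r : ℕ) : 0 < G.boundaryBall x₀ r := by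
  obtain ⟨y, hy⟩ := G.sphere_nonempty x₀ (r + 1)
  obtain ⟨x, hx, hb⟩ := G.exists_pos_of_dist_eq_succ x₀ hy
  rw [boundaryBall_eq_sum_sum]
  refine Finset.sum_pos' (fun _ _ => Finset.sum_nonneg fun _ _ => G.b_nonneg _ _)
    ⟨x, G.mem_sphereFinset.2 hx, ?_⟩
  exact Finset.sum_pos' (fun _ _ => G.b_nonneg _ _) ⟨y, G.mem_sphereFinset.2 hy, hb⟩

lemma boundaryBall_eq_outerCurvature_mul {x₀ : V}
    (h : G.IsSphericallySymmetric x₀ (G.outerCurvature x₀)) (x : V) :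
    G.boundaryBall x₀ (G.graph.dist x x₀) =
      G.outerCurvature x₀ x * G.sphereMeasure x₀ (G.graph.dist x x₀) := by
  obtain ⟨g, hg⟩ := h
  rw [boundaryBall_eq_sum, sphereMeasure, Finset.mul_sum]
  refine Finset.sum_congr rfl fun y hy => ?_
  rw [hg x, hg y, G.mem_sphereFinset.1 hy]

/-- The edge weight between `S_r` and `S_{r+1}` can also be summed from the outer side, where it is
`∑ κ₋ m` over `S_{r+1}`, with `κ₋` constant on that sphere. -/
lemma boundaryBall_eq_innerCurvature_mul {x₀ : V}
    (h : G.IsSphericallySymmetric x₀ (G.innerCurvature x₀)) {x : V} {r : ℕ}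
    (hx : G.graph.dist x x₀ = r + 1) :
    G.boundaryBall x₀ r = G.innerCurvature x₀ x * G.sphereMeasure x₀ (r + 1) := by
  obtain ⟨g, hg⟩ := h
  rw [boundaryBall_eq_sum_sum, Finset.sum_comm, sphereMeasure, Finset.mul_sum]
  refine Finset.sum_congr rfl fun y hy => ?_
  have hy' := G.mem_sphereFinset.1 hy
  rw [hg x, hx, ← hy', ← hg y, G.innerCurvature_mul x₀ hy']
  exact Finset.sum_congr rfl fun _ _ => G.b_symm _ _

lemma volumeBall_zero (x₀ : V) : G.volumeBall x₀ 0 = G.sphereMeasure x₀ 0 := by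
  rw [volumeBall, sphereMeasure, finsum_mem_eq_finite_toFinset_sum _ (G.finite_ball x₀ 0)]
  refine Finset.sum_congr ?_ fun _ _ => rfl
  ext x
  simp only [Set.Finite.mem_toFinset, mem_sphereFinset, ball, Set.mem_ofPred_eq]
  omega

lemma volumeBall_succ (x₀ : V) (r : ℕ) :
    G.volumeBall x₀ (r + 1) = G.volumeBall x₀ r + G.sphereMeasure x₀ (r + 1) := by
  classical
  rw [volumeBall, volumeBall, sphereMeasure,
    finsum_mem_eq_finite_toFinset_sum _ (G.finite_ball x₀ _),
    finsum_mem_eq_finite_toFinset_sum _ (G.finite_ball x₀ _), ← Finset.sum_union]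
  · refine Finset.sum_congr ?_ fun _ _ => rfl
    ext x
    simp only [Set.Finite.mem_toFinset, mem_sphereFinset, ball, Set.mem_ofPred_eq, Finset.mem_union]
    omega
  · rw [Finset.disjoint_left]
    intro x hx
    simp only [Set.Finite.mem_toFinset, mem_sphereFinset, ball, Set.mem_ofPred_eq] at hx ⊢
    omega

lemma volumeBall_pos [Infinite V] (x₀ : V) (r : ℕ) : 0 < G.volumeBall x₀ r := by
  induction r with
  | zero => rw [volumeBall_zero]; exact G.sphereMeasure_pos x₀ 0
  | succ r ih => rw [volumeBall_succ]; exact add_pos ih (G.sphereMeasure_pos x₀ _)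

/-- On a weakly spherically symmetric graph with `a = ∑ V₁(r) / ∂B(r) < ∞`, there
is a function `w` with `L w = 1` and `0 < w ≤ a` that vanishes at infinity. -/
theorem exists_torsion_function [Infinite V] {x₀ : V} (hG : G.IsWeaklySphericallySymmetric x₀)
    {a : ℝ} (ha : HasSum (fun r : ℕ => G.volumeBall x₀ r / G.boundaryBall x₀ r) a) :
    ∃ w : V → ℝ, (∀ x, 0 < w x) ∧ (∀ x, w x ≤ a) ∧ (∀ x, G.formalLaplacian w x = G.m x) ∧
      ∀ ε > 0, {x | ε ≤ w x}.Finite := by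
  set t : ℕ → ℝ := fun r => G.volumeBall x₀ r / G.boundaryBall x₀ r with ht
  have htpos : ∀ r, 0 < t r := fun r => div_pos (G.volumeBall_pos x₀ r) (G.boundaryBall_pos x₀ r)
  -- This is the tail `∑_{k ≥ r} t k`, which makes positivity, the bound by `a` and decay to `0`
  -- available.
  set v : ℕ → ℝ := fun r => a - ∑ k ∈ Finset.range r, t k with hv
  have hvs : ∀ r, v r - v (r + 1) = t r := fun r => by
    simp only [hv, Finset.sum_range_succ]
    ring
  refine ⟨fun x => v (G.graph.dist x x₀), fun x => ?_, fun x => ?_, fun x => ?_, fun ε hε => ?_⟩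
  · have h1 := sum_le_hasSum (Finset.range (G.graph.dist x x₀ + 1)) (fun k _ => (htpos k).le) ha
    rw [Finset.sum_range_succ] at h1
    have h2 := htpos (G.graph.dist x x₀)
    simp only [hv]
    linarith
  · have h1 : 0 ≤ ∑ k ∈ Finset.range (G.graph.dist x x₀), t k :=
      Finset.sum_nonneg fun k _ => (htpos k).le
    simp only [hv]
    linarith
  · rw [formalLaplacian_radial, hvs]
    have h1 := G.boundaryBall_eq_outerCurvature_mul hG.1 x
    rcases hr : G.graph.dist x x₀ with _ | r
    · rw [hr] at h1
      have h2 := G.boundaryBall_pos x₀ 0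
      rw [innerCurvature_eq_zero G x₀ hr, zero_mul, zero_mul, add_zero, ht]
      simp only
      rw [mul_div_assoc', div_eq_iff h2.ne', volumeBall_zero, h1]
      ring
    · rw [hr] at h1
      have h2 := G.boundaryBall_eq_innerCurvature_mul hG.2 hr
      have h3 := G.boundaryBall_pos x₀ (r + 1)
      have h4 := G.boundaryBall_pos x₀ r
      have h5 := G.sphereMeasure_pos x₀ (r + 1)
      have h6 : v (r + 1) - v (r + 1 - 1) = - t r := by
        rw [← hvs r, Nat.add_sub_cancel]
        ring
      -- Both curvature terms have denominator `m(S_{r+1})`, and the numerators `V_1(r+1)` and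
      -- `V_1(r)` differ by exactly that measure.
      have h7 : G.outerCurvature x₀ x * t (r + 1) =
          G.volumeBall x₀ (r + 1) / G.sphereMeasure x₀ (r + 1) := by
        rw [ht, eq_div_iff h5.ne']
        simp only
        rw [mul_right_comm, ← h1, mul_div_cancel₀ _ h3.ne']
      have h8 : G.innerCurvature x₀ x * t r =
          G.volumeBall x₀ r / G.sphereMeasure x₀ (r + 1) := by
        rw [ht, eq_div_iff h5.ne']
        simp only
        rw [mul_right_comm, ← h2, mul_div_cancel₀ _ h4.ne']
      rw [h6]
      calc _ = G.m x * (G.outerCurvature x₀ x * t (r + 1) - G.innerCurvature x₀ x * t r) := by ring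
        _ = G.m x := by
          rw [h7, h8, ← sub_div, volumeBall_succ, add_sub_cancel_left, div_self h5.ne', mul_one]
  · have h1 : Tendsto v atTop (𝓝 0) := by
      have := (tendsto_const_nhds (x := a)).sub ha.tendsto_sum_nat
      rwa [sub_self] at this
    obtain ⟨R, hR⟩ := eventually_atTop.1 (h1.eventually_lt_const hε)
    refine (G.finite_ball x₀ R).subset fun x hx => ?_
    by_contra hx'
    exact absurd (hR _ (not_le.1 hx').le) (not_lt.2 hx)

/-! ### Green's formula and Hardy's inequality -/

/-- Green's formula for a finitely supported function `ψ`. -/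
lemma hasSum_green (w ψ : V → ℝ) {S : Finset V} (hS : ∀ x ∉ S, ψ x = 0) :
    HasSum (fun p : V × V => G.b p.1 p.2 * (w p.1 - w p.2) * (ψ p.1 - ψ p.2))
      (2 * ∑ x ∈ S, ψ x * G.formalLaplacian w x) := by
  classical
  -- `A` is the half carrying `ψ p.1`; swapping the coordinates gives the other half, by symmetry of
  -- `b`. Each half has only finitely many nonzero terms, so no energy bound on `w` enters.
  set A : V × V → ℝ := fun p => G.b p.1 p.2 * (w p.1 - w p.2) * ψ p.1 with hA
  have h1 : HasSum A (∑ x ∈ S, ψ x * G.formalLaplacian w x) := by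
    have h2 : ∑ x ∈ S, ψ x * G.formalLaplacian w x = ∑ p ∈ S ×ˢ S.biUnion G.neighbors, A p := by
      rw [Finset.sum_product]
      refine Finset.sum_congr rfl fun x hx => ?_
      rw [formalLaplacian, Finset.mul_sum]
      refine Finset.sum_subset_zero_on_sdiff (Finset.subset_biUnion_of_mem G.neighbors hx)
        (fun y hy => ?_) fun y _ => ?_
      · simp [hA, G.b_eq_zero_of_notMem (Finset.mem_sdiff.1 hy).2]
      · simp only [hA]
        ring
    rw [h2]
    refine hasSum_sum_of_ne_finset_zero fun p hp => ?_
    by_cases hx : p.1 ∈ S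
    · have hy : p.2 ∉ G.neighbors p.1 := fun h =>
        hp (Finset.mem_product.2 ⟨hx, Finset.mem_biUnion.2 ⟨p.1, hx, h⟩⟩)
      simp [hA, G.b_eq_zero_of_notMem hy]
    · simp [hA, hS _ hx]
  have h3 : HasSum (A ∘ Equiv.prodComm V V) (∑ x ∈ S, ψ x * G.formalLaplacian w x) :=
    (Equiv.prodComm V V).hasSum_iff.2 h1
  rw [two_mul]
  refine (h1.add h3).congr_fun fun p => ?_
  simp only [hA, Function.comp_apply, Equiv.prodComm_apply, Prod.fst_swap, Prod.snd_swap]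
  rw [G.b_symm p.2 p.1]
  ring

/-- The pointwise inequality behind the ground state transform. -/
lemma sub_mul_sub_le_sq {p q : ℝ} (hp : 0 < p) (hq : 0 < q) (s t : ℝ) :
    (p - q) * (s ^ 2 / p - t ^ 2 / q) ≤ (s - t) * (s - t) := by
  have h : (s - t) * (s - t) - (p - q) * (s ^ 2 / p - t ^ 2 / q) =
      (q * s - p * t) ^ 2 / (p * q) := by
    field_simp
    ring
  have h2 : 0 ≤ (q * s - p * t) ^ 2 / (p * q) := by positivity
  linarith

/-- Hardy's inequality for finitely supported functions. -/
lemma sum_le_form {w : V → ℝ} (hw : ∀ x, 0 < w x) (hL : ∀ x, G.formalLaplacian w x = G.m x)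
    {φ : V → ℝ} (hφ : (Function.support φ).Finite) (F : Finset V) :
    ∑ x ∈ F, φ x ^ 2 * G.m x / w x ≤ G.form φ φ := by
  classical
  set S := F ∪ hφ.toFinset with hS
  have hS0 : ∀ x ∉ S, φ x ^ 2 / w x = 0 := fun x hx => by
    have : φ x = 0 := by
      by_contra h
      exact hx (Finset.mem_union_right _ (hφ.mem_toFinset.2 h))
    simp [this]
  -- Since `L w = 1`, testing with `φ² / w` produces `2 ∑ φ² m / w`; the pointwise inequality bounds
  -- it termwise by twice the energy.
  have h1 := G.hasSum_green w (fun x => φ x ^ 2 / w x) hS0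
  have h2 := hasSum_le (fun p => ?_) h1 (finiteEnergy_of_finite_support (G := G) hφ).hasSum
  · have h3 : ∑ x ∈ F, φ x ^ 2 * G.m x / w x ≤ ∑ x ∈ S, φ x ^ 2 / w x * G.formalLaplacian w x := by
      refine (Finset.sum_le_sum_of_subset_of_nonneg Finset.subset_union_left
        fun x _ _ => ?_).trans_eq (Finset.sum_congr rfl fun x _ => ?_)
      · have := hw x
        have := G.m_pos x
        positivity
      · rw [hL]
        ring
    unfold form
    linarith
  · rw [mul_assoc, mul_assoc]
    exact mul_le_mul_of_nonneg_left (sub_mul_sub_le_sq (hw _) (hw _) _ _) (G.b_nonneg _ _)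

/-! ### Point evaluations and finite-rank restrictions on `ℓ²(V, m)` -/

section L2

variable [MeasurableSpace V] [DiscreteMeasurableSpace V]

lemma hasSum_integral {F : V → ℝ} (hF : Integrable F G.measure) :
    HasSum (fun x => F x * G.m x) (∫ x, F x ∂G.measure) := by
  unfold measure at hF ⊢
  refine (hasSum_integral_measure hF).congr_fun fun x => ?_
  rw [integral_smul_measure, integral_dirac, ENNReal.toReal_ofReal (G.m_pos x).le, smul_eq_mul,
    mul_comm]

lemma hasSum_inner (f g : G.L2) :
    HasSum (fun x => f x * g x * G.m x) (inner ℝ f g) := by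
  rw [L2.inner_def]
  refine (G.hasSum_integral (L2.integrable_inner (𝕜 := ℝ) f g)).congr_fun fun x => ?_
  simp only [RCLike.inner_apply, conj_trivial]
  ring

lemma hasSum_norm_sq (f : G.L2) : HasSum (fun x => f x ^ 2 * G.m x) (‖f‖ ^ 2) := by
  rw [← real_inner_self_eq_norm_sq]
  refine (G.hasSum_inner f f).congr_fun fun x => ?_
  ring

lemma exists_coe_eq_indicator (x : V) :
    ∃ δ : G.L2, (δ : V → ℝ) = Set.indicator {x} fun _ => (1 : ℝ) := by
  have hx : G.measure {x} ≠ ⊤ := by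
    rw [measure, Measure.sum_apply _ (MeasurableSet.of_discrete), tsum_eq_single x]
    · simp
    · intro y hy
      simp [hy]
  exact ⟨indicatorConstLp 2 (MeasurableSet.of_discrete (s := {x})) hx (1 : ℝ),
    G.eq_of_ae_eq indicatorConstLp_coeFn⟩

/-- The indicator function of a vertex as an element of `ℓ²(V, m)`. -/
noncomputable def delta (x : V) : G.L2 := (G.exists_coe_eq_indicator x).choose

lemma coe_delta (x : V) : (G.delta x : V → ℝ) = Set.indicator {x} fun _ => (1 : ℝ) :=
  (G.exists_coe_eq_indicator x).choose_spec

lemma delta_ne_zero (x : V) : G.delta x ≠ 0 := fun h => by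
  have h1 : (G.delta x : V → ℝ) x = 0 := by rw [h, G.coe_zero, Pi.zero_apply]
  simp [coe_delta] at h1

lemma inner_delta (x : V) (f : G.L2) : inner ℝ (G.delta x) f = f x * G.m x := by
  refine (G.hasSum_inner _ f).unique ?_
  rw [coe_delta]
  convert hasSum_single x fun y hy => ?_ using 1
  · simp
  · simp [hy]

/-- Evaluation at a vertex as a continuous functional on `ℓ²(V, m)`. -/
noncomputable def eval (x : V) : G.L2 →L[ℝ] ℝ := (G.m x)⁻¹ • innerSL ℝ (G.delta x)

lemma eval_apply (x : V) (f : G.L2) : G.eval x f = f x := by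
  have h := (G.m_pos x).ne'
  simp only [eval, smul_apply, innerSL_apply_apply, inner_delta, smul_eq_mul]
  field_simp

/-- Restriction of functions to a finite set. -/
noncomputable def restrictFinset (F : Finset V) : G.L2 →L[ℝ] G.L2 :=
  ∑ x ∈ F, (G.eval x).smulRight (G.delta x)

open Classical in
lemma restrictFinset_apply (F : Finset V) (f : G.L2) (x : V) :
    G.restrictFinset F f x = if x ∈ F then f x else 0 := by
  rw [← eval_apply, restrictFinset, sum_apply, map_sum]
  simp only [ContinuousLinearMap.smulRight_apply, map_smul, eval_apply, coe_delta, smul_eq_mul,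
    Set.indicator_apply, Set.mem_singleton_iff, mul_ite, mul_one, mul_zero]
  exact Finset.sum_ite_eq F x _

lemma isCompactOperator_restrictFinset (F : Finset V) : IsCompactOperator (G.restrictFinset F) := by
  refine Submodule.sum_mem (compactOperator (RingHom.id ℝ) G.L2 G.L2) (fun x _ => ?_)
  exact (isCompactOperator_of_locallyCompactSpace_dom (G.eval x)).clm_comp
    (ContinuousLinearMap.toSpanSingleton ℝ (G.delta x))

end L2

/-! ### The form domain as a closed graph -/

/-- The weighted discrete gradient, normalized so that its square sum is the energy. -/
noncomputable def gradient (f : V → ℝ) (p : V × V) : ℝ := √(G.b p.1 p.2 / 2) * (f p.1 - f p.2)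

lemma gradient_mul_gradient (f g : V → ℝ) (p : V × V) :
    G.gradient f p * G.gradient g p =
      (1 / 2) * (G.b p.1 p.2 * (f p.1 - f p.2) * (g p.1 - g p.2)) := by
  have h := Real.mul_self_sqrt (div_nonneg (G.b_nonneg p.1 p.2) zero_le_two)
  calc _ = √(G.b p.1 p.2 / 2) * √(G.b p.1 p.2 / 2) * ((f p.1 - f p.2) * (g p.1 - g p.2)) := by
        simp only [gradient]; ring
    _ = _ := by rw [h]; ring

variable {G} in
lemma FiniteEnergy.memℓp_gradient {f : V → ℝ} (hf : G.FiniteEnergy f) :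
    Memℓp (E := fun _ : V × V => ℝ) (G.gradient f) 2 := by
  refine memℓp_gen ((Summable.mul_left (1 / 2) hf).congr fun p => ?_)
  rw [← gradient_mul_gradient]
  simp [sq]

variable [MeasurableSpace V]

/-- The Hilbert space containing the graph of the gradient. -/
abbrev GradientSpace : Type _ := WithLp 2 (G.L2 × lp (fun _ : V × V => ℝ) 2)

lemma finiteEnergy_of_snd_eq {z : G.GradientSpace} (hz : ∀ p, z.snd p = G.gradient z.fst p) :
    G.FiniteEnergy z.fst := by
  refine (Summable.mul_left 2 (lp.summable_inner (𝕜 := ℝ) z.snd z.snd)).congr fun p => ?_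
  rw [hz p, RCLike.inner_apply, conj_trivial, gradient_mul_gradient]
  ring

lemma inner_snd_eq_form {y z : G.GradientSpace} (hy : ∀ p, y.snd p = G.gradient y.fst p)
    (hz : ∀ p, z.snd p = G.gradient z.fst p) : inner ℝ y.snd z.snd = G.form y.fst z.fst := by
  rw [lp.inner_eq_tsum, form, ← tsum_mul_left]
  refine tsum_congr fun p => ?_
  rw [hz p, hy p, RCLike.inner_apply, conj_trivial, mul_comm, gradient_mul_gradient]

lemma norm_sq_eq {z : G.GradientSpace} (hz : ∀ p, z.snd p = G.gradient z.fst p) :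
    ‖z‖ ^ 2 = ‖z.fst‖ ^ 2 + G.form z.fst z.fst := by
  rw [WithLp.prod_norm_sq_eq_of_L2, ← G.inner_snd_eq_form hz hz, real_inner_self_eq_norm_sq]

variable [DiscreteMeasurableSpace V]

/-- The graph of the gradient on finitely supported functions. -/
def finiteGradientGraph : Submodule ℝ G.GradientSpace where
  carrier := {z | (Function.support z.fst).Finite ∧ ∀ p, z.snd p = G.gradient z.fst p}
  zero_mem' := by
    have h0 : ((0 : G.GradientSpace).fst : V → ℝ) = 0 := G.coe_zero
    rw [Set.mem_ofPred_eq, h0]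
    simp [gradient]
  add_mem' := by
    rintro y z ⟨hy, hy'⟩ ⟨hz, hz'⟩
    refine ⟨?_, fun p => ?_⟩
    · rw [WithLp.add_fst, G.coe_add]
      exact (hy.union hz).subset (Function.support_add _ _)
    · rw [WithLp.add_fst, G.coe_add, WithLp.add_snd, lp.coeFn_add, Pi.add_apply, hy', hz']
      simp only [gradient, Pi.add_apply]
      ring
  smul_mem' := by
    rintro c z ⟨hz, hz'⟩
    refine ⟨?_, fun p => ?_⟩
    · rw [WithLp.smul_fst, G.coe_smul]
      exact hz.subset (Function.support_const_smul_subset c _)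
    · rw [WithLp.smul_fst, G.coe_smul, WithLp.smul_snd, lp.coeFn_smul, Pi.smul_apply, hz']
      simp only [gradient, Pi.smul_apply, smul_eq_mul]
      ring

/-- The form domain with the form norm, realized as the closure of the graph of the gradient on
finitely supported functions. -/
noncomputable def formSpace : Submodule ℝ G.GradientSpace :=
  G.finiteGradientGraph.topologicalClosure

instance : CompleteSpace G.formSpace :=
  G.finiteGradientGraph.isClosed_topologicalClosure.completeSpace_coe

/-- Closability of the form: values at single vertices are continuous in `ℓ²`, so the relation
between a function and its gradient survives limits. -/
lemma snd_eq_gradient {z : G.GradientSpace} (hz : z ∈ G.formSpace) (p : V × V) :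
    z.snd p = G.gradient z.fst p := by
  have h1 : Continuous fun z : G.GradientSpace => z.snd p :=
    ((lp.evalCLM ℝ (fun _ : V × V => ℝ) 2 p).comp (WithLp.sndL 2 ℝ _ _)).continuous
  have h2 : ∀ x, Continuous fun z : G.GradientSpace => z.fst x := fun x => by
    simp only [← eval_apply]
    exact ((G.eval x).comp (WithLp.fstL 2 ℝ _ _)).continuous
  have h3 : Continuous fun z : G.GradientSpace => G.gradient z.fst p :=
    ((h2 p.1).sub (h2 p.2)).const_mul _
  exact closure_minimal (fun z hz => hz.2 p) (isClosed_eq h1 h3) hz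

lemma sub_snd_eq {y z : G.GradientSpace} (hy : ∀ p, y.snd p = G.gradient y.fst p)
    (hz : ∀ p, z.snd p = G.gradient z.fst p) (p : V × V) :
    (y - z).snd p = G.gradient (y - z).fst p := by
  rw [WithLp.sub_fst, G.coe_sub, WithLp.sub_snd, lp.coeFn_sub, Pi.sub_apply, hy, hz]
  simp only [gradient, Pi.sub_apply]
  ring

/-- With `exists_mem_formSpace`, this identifies `D(Q)` with the complete space `formSpace`, whose
norm is the form norm; completeness is what allows adjoints later. -/
lemma fst_mem_formDomain {z : G.GradientSpace} (hz : z ∈ G.formSpace) :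
    z.fst ∈ G.formDomain := by
  refine ⟨G.finiteEnergy_of_snd_eq (G.snd_eq_gradient hz), fun ε hε => ?_⟩
  obtain ⟨y, hy, hd⟩ := Metric.mem_closure_iff.1 hz (√ε) (Real.sqrt_pos.2 hε)
  refine ⟨y.fst, hy.1, ?_⟩
  rw [← WithLp.sub_fst, ← G.norm_sq_eq (G.sub_snd_eq (G.snd_eq_gradient hz) hy.2),
    ← dist_eq_norm]
  exact (Real.lt_sqrt dist_nonneg).1 hd

lemma exists_mem_formSpace {f : G.L2} (hf : f ∈ G.formDomain) :
    ∃ z ∈ G.formSpace, z.fst = f := by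
  obtain ⟨hE, happ⟩ := hf
  refine ⟨WithLp.toLp 2 (f, ⟨G.gradient f, hE.memℓp_gradient⟩), ?_, rfl⟩
  refine Metric.mem_closure_iff.2 fun ε hε => ?_
  obtain ⟨φ, hφ, hlt⟩ := happ (ε ^ 2) (by positivity)
  refine ⟨WithLp.toLp 2 (φ, ⟨G.gradient φ,
    (finiteEnergy_of_finite_support (G := G) hφ).memℓp_gradient⟩), ⟨hφ, fun _ => rfl⟩, ?_⟩
  rw [dist_eq_norm]
  refine lt_of_pow_lt_pow_left₀ 2 hε.le ?_
  rw [G.norm_sq_eq (G.sub_snd_eq (fun _ => rfl) fun _ => rfl)]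
  exact hlt

/-! ### Hardy's inequality on the form domain and compactness of the embedding -/

/-- Hardy's inequality on the form domain. -/
lemma sum_le_form_of_mem_formDomain {w : V → ℝ} (hw : ∀ x, 0 < w x)
    (hL : ∀ x, G.formalLaplacian w x = G.m x) {f : G.L2} (hf : f ∈ G.formDomain) (F : Finset V) :
    ∑ x ∈ F, f x ^ 2 * G.m x / w x ≤ G.form f f := by
  obtain ⟨z, hz, rfl⟩ := G.exists_mem_formSpace hf
  have h1 := G.snd_eq_gradient hz
  rw [← G.inner_snd_eq_form h1 h1]
  have hc1 : Continuous fun z : G.GradientSpace => ∑ x ∈ F, z.fst x ^ 2 * G.m x / w x := by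
    refine continuous_finsetSum _ fun x _ => ?_
    simp only [← eval_apply]
    exact ((((G.eval x).comp (WithLp.fstL 2 ℝ _ _)).continuous.pow 2).mul_const _).div_const _
  have hc2 : Continuous fun z : G.GradientSpace => inner ℝ z.snd z.snd :=
    (WithLp.sndL 2 ℝ _ _).continuous.inner (WithLp.sndL 2 ℝ _ _).continuous
  -- For a finite `F` both sides are continuous in the form norm, so the inequality extends from
  -- finite supports.
  refine closure_minimal (fun y hy => ?_) (isClosed_le hc1 hc2) hz
  rw [Set.mem_ofPred_eq, G.inner_snd_eq_form hy.2 hy.2]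
  exact G.sum_le_form hw hL hy.1 F

/-- The tail of a function in the form domain is controlled by its energy. -/
lemma norm_sq_sub_restrictFinset_le {w : V → ℝ} (hw : ∀ x, 0 < w x)
    (hL : ∀ x, G.formalLaplacian w x = G.m x) {f : G.L2} (hf : f ∈ G.formDomain) {F : Finset V}
    {ε : ℝ} (hε : 0 ≤ ε) (hF : ∀ x ∉ F, w x ≤ ε) :
    ‖f - G.restrictFinset F f‖ ^ 2 ≤ ε * G.form f f := by
  -- Off `F` one has `1 ≤ ε / w`, so each term is at most `ε` times the Hardy term; on `F` it is
  -- zero.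
  refine hasSum_le_of_sum_le (G.hasSum_norm_sq _) fun S => ?_
  refine le_trans ?_ (mul_le_mul_of_nonneg_left
    (G.sum_le_form_of_mem_formDomain hw hL hf S) hε)
  rw [Finset.mul_sum]
  refine Finset.sum_le_sum fun x _ => ?_
  have h1 := hw x
  have h2 := G.m_pos x
  rw [G.coe_sub, Pi.sub_apply, restrictFinset_apply]
  split_ifs with hx
  · rw [sub_self]
    have : 0 ≤ ε * (f x ^ 2 * G.m x / w x) := by positivity
    simpa using this
  · rw [sub_zero, ← mul_div_assoc, le_div_iff₀ h1, mul_comm]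
    exact mul_le_mul_of_nonneg_right (hF x hx) (by positivity)

/-- The embedding of the form domain into `ℓ²(V, m)`. -/
noncomputable def embedding : G.formSpace →L[ℝ] G.L2 :=
  (WithLp.fstL 2 ℝ _ _).comp G.formSpace.subtypeL

lemma embedding_apply (z : G.formSpace) : G.embedding z = (z : G.GradientSpace).fst := rfl

/-- Restricting to the finite set `{w ≥ ε²}` has finite rank, and the tail estimate bounds the error
by `ε` times the form norm; the square appears because that estimate concerns squared norms. -/
lemma isCompactOperator_embedding {w : V → ℝ} (hw : ∀ x, 0 < w x)
    (hL : ∀ x, G.formalLaplacian w x = G.m x) (hfin : ∀ ε > 0, {x | ε ≤ w x}.Finite) :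
    IsCompactOperator G.embedding := by
  refine isCompactOperator_of_forall_exists_norm_sub_le fun ε hε => ?_
  set F := (hfin (ε ^ 2) (by positivity)).toFinset
  refine ⟨(G.restrictFinset F).comp G.embedding,
    (G.isCompactOperator_restrictFinset F).comp_clm _, fun z => ?_⟩
  refine le_of_pow_le_pow_left₀ two_ne_zero (by positivity) ?_
  have h1 := G.norm_sq_sub_restrictFinset_le hw hL (G.fst_mem_formDomain z.2) (F := F)
    (sq_nonneg ε) fun x hx => (by
      by_contra h
      exact hx ((Set.Finite.mem_toFinset _).2 (not_le.1 h).le))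
  have h2 := G.norm_sq_eq (G.snd_eq_gradient z.2)
  rw [mul_pow]
  refine h1.trans (mul_le_mul_of_nonneg_left ?_ (by positivity))
  rw [Submodule.coe_norm, h2]
  nlinarith [sq_nonneg ‖(z : G.GradientSpace).fst‖]

/-! ### The resolvent and the Laplacian -/

/-- The resolvent `(L + 1)⁻¹`. -/
noncomputable def resolvent : G.L2 →L[ℝ] G.L2 := G.embedding ∘L G.embedding.adjoint

lemma isCompactOperator_resolvent {w : V → ℝ} (hw : ∀ x, 0 < w x)
    (hL : ∀ x, G.formalLaplacian w x = G.m x) (hfin : ∀ ε > 0, {x | ε ≤ w x}.Finite) :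
    IsCompactOperator G.resolvent :=
  (G.isCompactOperator_embedding hw hL hfin).comp_clm _

/-- The inner product of `formSpace` is `⟨·,·⟩ + Q`, so the defining property of the adjoint of the
embedding is the weak equation `(L + 1) u = h`. -/
lemma form_add_inner_adjoint (h : G.L2) {g : G.L2} (hg : g ∈ G.formDomain) :
    G.form (G.resolvent h) g + inner ℝ (G.resolvent h) g = inner ℝ h g := by
  obtain ⟨z, hz, rfl⟩ := G.exists_mem_formSpace hg
  have h1 := ContinuousLinearMap.adjoint_inner_left G.embedding ⟨z, hz⟩ h
  set u := G.embedding.adjoint h with hu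
  rw [Submodule.coe_inner, WithLp.prod_inner_apply] at h1
  have h2 := G.inner_snd_eq_form (G.snd_eq_gradient u.2) (G.snd_eq_gradient hz)
  have h3 : G.resolvent h = (u : G.GradientSpace).fst := rfl
  rw [h3, ← h2, add_comm]
  exact h1

lemma mem_laplacianGraph_resolvent (h : G.L2) :
    (G.resolvent h, h - G.resolvent h) ∈ G.laplacianGraph := by
  refine ⟨G.fst_mem_formDomain (G.embedding.adjoint h).2, fun g hg => ?_⟩
  rw [inner_sub_left, ← G.form_add_inner_adjoint h hg, add_sub_cancel_right]

/-- A weak solution of `(L + 1) f = h` pairs with every element of `formSpace` exactly as the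
adjoint applied to `h` does, hence equals it. -/
lemma resolvent_add_of_mem_laplacianGraph {p : G.L2 × G.L2} (hp : p ∈ G.laplacianGraph) :
    G.resolvent (p.2 + p.1) = p.1 := by
  obtain ⟨z, hz, hzp⟩ := G.exists_mem_formSpace hp.1
  have h1 : G.embedding.adjoint (p.2 + p.1) = ⟨z, hz⟩ := by
    refine ext_inner_right ℝ fun y => ?_
    rw [ContinuousLinearMap.adjoint_inner_left, inner_add_left, embedding_apply,
      ← hp.2 _ (G.fst_mem_formDomain y.2), Submodule.coe_inner, WithLp.prod_inner_apply,
      ← hzp, ← G.inner_snd_eq_form (G.snd_eq_gradient hz) (G.snd_eq_gradient y.2), add_comm]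
    rfl
  rw [resolvent, ContinuousLinearMap.comp_apply, h1]
  exact hzp

lemma isSymmetric_resolvent : (G.resolvent : G.L2 →ₗ[ℝ] G.L2).IsSymmetric := fun f g => by
  simp only [resolvent, ContinuousLinearMap.coe_coe, ContinuousLinearMap.comp_apply]
  rw [← ContinuousLinearMap.adjoint_inner_right, ContinuousLinearMap.adjoint_inner_left]

lemma mem_laplacianGraph_of_mem_domain (f : G.laplacian.domain) :
    ((f : G.L2), G.laplacian f) ∈ G.laplacianGraph := by
  rw [← laplacian_graph]
  exact G.laplacian.mem_graph f

lemma exists_laplacian_eq {p : G.L2 × G.L2} (hp : p ∈ G.laplacianGraph) :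
    ∃ h : p.1 ∈ G.laplacian.domain, G.laplacian ⟨p.1, h⟩ = p.2 := by
  rw [← laplacian_graph, LinearPMap.mem_graph_iff] at hp
  obtain ⟨y, hy, hy'⟩ := hp
  have h : p.1 ∈ G.laplacian.domain := hy ▸ y.2
  refine ⟨h, ?_⟩
  rw [← hy']
  congr 1
  exact Subtype.ext hy.symm

lemma resolvent_laplacian_add (f : G.laplacian.domain) : 
    G.resolvent (G.laplacian f + f) = f :=
  G.resolvent_add_of_mem_laplacianGraph (p := (f, G.laplacian f))
    (G.mem_laplacianGraph_of_mem_domain f)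

lemma laplacian_resolvent_add (g : G.L2) : ∃ hg : G.resolvent g ∈ G.laplacian.domain,
    G.laplacian ⟨G.resolvent g, hg⟩ + G.resolvent g = g := by
  obtain ⟨h, h'⟩ := G.exists_laplacian_eq (G.mem_laplacianGraph_resolvent g)
  exact ⟨h, by rw [h', sub_add_cancel]⟩

/-- The tail estimate with an empty finite set: `w ≤ a` holds everywhere, so the whole function is
tail. -/
lemma norm_sq_le_inner_laplacian {w : V → ℝ} (hw : ∀ x, 0 < w x)
    (hL : ∀ x, G.formalLaplacian w x = G.m x) {a : ℝ} (ha : 0 ≤ a) (hwa : ∀ x, w x ≤ a)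
    (f : G.laplacian.domain) : ‖(f : G.L2)‖ ^ 2 ≤ a * inner ℝ (G.laplacian f) (f : G.L2) := by
  have hf := G.mem_laplacianGraph_of_mem_domain f
  have h1 := G.norm_sq_sub_restrictFinset_le hw hL hf.1 (F := ∅) ha fun x _ => hwa x
  rw [restrictFinset, Finset.sum_empty, zero_apply, sub_zero] at h1
  rw [← hf.2 _ hf.1]
  exact h1

end WeightedGraph

/-- The first two conjuncts make `bottom` a genuine infimum: the real `sInf` takes the default value
`0` on sets that are empty or unbounded below. -/
theorem theoremt {V : Type*} [Countable V] [Infinite V] [MeasurableSpace V]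
    [DiscreteMeasurableSpace V] (G : WeightedGraph V) (x₀ : V)
    (hG : G.IsWeaklySphericallySymmetric x₀) (a : ℝ)
    (ha : HasSum (fun r : ℕ => G.volumeBall x₀ r / G.boundaryBall x₀ r) a) :
    (UnboundedSpectrum.spec G.laplacian).Nonempty ∧
      BddBelow (UnboundedSpectrum.spec G.laplacian) ∧
      1 / a ≤ UnboundedSpectrum.bottom G.laplacian ∧
      UnboundedSpectrum.spec G.laplacian = UnboundedSpectrum.discreteSpec G.laplacian := by
  obtain ⟨w, hw, hwa, hL, hfin⟩ := G.exists_torsion_function hG ha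
  have ha0 : 0 < a := (hw x₀).trans_le (hwa x₀)
  have : Nontrivial G.L2 := ⟨G.delta x₀, 0, G.delta_ne_zero x₀⟩
  obtain ⟨hne, hbd, hdisc⟩ :=
    UnboundedSpectrum.spec_eq_discreteSpec_of_compact_resolvent (c := 1 / a)
      (G.isCompactOperator_resolvent hw hL hfin) G.isSymmetric_resolvent
      G.resolvent_laplacian_add G.laplacian_resolvent_add fun f => by
        rw [one_div, inv_mul_le_iff₀ ha0]
        exact G.norm_sq_le_inner_laplacian hw hL ha0.le hwa f
  exact ⟨hne, ⟨1 / a, hbd⟩, le_csInf hne hbd, hdisc⟩
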